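/- Let $\omega$ be a primitive cube root of unity. In $\mathbb{C}^5\otimes\mathbb{C}^5$ (Alice holds the first factor, Bob the second) consider the unnormalized states $$|\phi_1\rangle=|00\rangle+|11\rangle+|22\rangle+|33\rangle+|44\rangle,\quad |\phi_2\rangle=|00\rangle-|11\rangle-|22\rangle-\omega|33\rangle-\omega^2|44\rangle,\quad |\phi_3\rangle=|01\rangle+|23\rangle .$$ A finite family of states is called locally distinguishable if some LOCC protocol (finitely many rounds; in each round Alice or Bob performs on their own system a measurement with finitely many outcomes, chosen depending on all earlier outcomes, possibly with local ancillas) identifies with certainty which state of the family is given; otherwise it is locally indistinguishable. A family has local redundancy if, for some tensor factorizations of Alice's and of Bob's space, the states remain mutually orthogonal after one or more nontrivial local subsystems have been discarded. Then: 1. $\phi_1,\phi_2,\phi_3$ are nonzero and mutually orthogonal, have no local redundancy, and are locally distinguishable. 2. Let $P_{01}=|0\rangle\langle0|+|1\rangle\langle1|$ and $P_{234}=|2\rangle\langle2|+|3\rangle\langle3|+|4\rangle\langle4|$. Then $\{P_{01},P_{234}\}$ is a projective measurement of Alice which is nontrivial (not all of its operators are multiples of the identity) and preserves the mutual orthogonality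 of $\phi_1,\phi_2,\phi_3$. For each of its two outcomes the three post-measurement states are nonzero, mutually orthogonal and locally indistinguishable. Hence Alice's measurement converts the locally distinguishable set, with certainty, into a locally indistinguishable orthogonal set of the same cardinality. More precisely: (a) For the outcome $P_{01}$ the post-measurement states are $|00\rangle+|11\rangle$, $|00\rangle-|11\rangle$, $|01\rangle$. They are the image, under the local isometric embedding $|i\rangle\mapsto|i\rangle$ of $\mathbb{C}^2\otimes\mathbb{C}^2$, of the two-qubit triple given by the same formulas, and this triple is locally indistinguishable in $\mathbb{C}^2\otimes\mathbb{C}^2$. (b) For the outcome $P_{234}$ the post-measurement states are $|22\rangle+|33\rangle+|44\rangle$, $-(|22\rangle+\omega|33\rangle+\omega^2|44\rangle)$, $|23\rangle$. They are the image, under the local isometric embedding $|i\rangle\mapsto|i+2\rangle$ of $\mathbb{C}^3\otimes\mathbb{C}^3$, of the triple $|00\rangle+|11\rangle+|22\rangle$, $-(|00\rangle+\omega|11\rangle+\omega^2|22\rangle)$, $|01\rangle$. The first two states of the latter triple are maximally entangled in $\mathbb{C}^3\otimes\mathbb{C}^3$, and the triple is locally indistinguishable in $\mathbb{C}^3\otimes\mathbb{C}^3$.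 -/

import Mathlib

open Matrix
open scoped Kronecker

noncomputable section

namespace LOCC

/-- The Hilbert space `ℂ^a ⊗ ℂ^b` of Alice and Bob, in coordinates with respect to the product
basis. Its elements are (unnormalized) pure states. -/
abbrev State (a b : ℕ) : Type := EuclideanSpace ℂ (Fin a × Fin b)

/-- The product basis vector `|i j⟩`. -/
def ket {a b : ℕ} (i : Fin a) (j : Fin b) : State a b := EuclideanSpace.single (i, j) 1

/-- The vector `(A ⊗ B) ψ`. -/
def localApply {a b a' b' : ℕ} (A : Matrix (Fin a') (Fin a) ℂ) (B : Matrix (Fin b') (Fin b) ℂ)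
    (ψ : State a b) : State a' b' :=
  WithLp.toLp 2 ((A ⊗ₖ B) *ᵥ ψ.ofLp)

/-- The vector `(K ⊗ 1) ψ`: Alice applies `K` to her subsystem. -/
def aliceApply {a b a' : ℕ} (K : Matrix (Fin a') (Fin a) ℂ) (ψ : State a b) : State a' b :=
  localApply K (1 : Matrix (Fin b) (Fin b) ℂ) ψ

/-- The vector `(1 ⊗ K) ψ`: Bob applies `K` to his subsystem. -/
def bobApply {a b b' : ℕ} (K : Matrix (Fin b') (Fin b) ℂ) (ψ : State a b) : State a b' :=
  localApply (1 : Matrix (Fin a) (Fin a) ℂ) K ψ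

/-- A finite family of operators `K k` on `ℂ^d` (with values in possibly different output spaces)
is a quantum measurement if `∑ k, (K k)† (K k) = 1`. -/
def IsMeasurement {d m : ℕ} {d' : Fin m → ℕ} (K : ∀ k, Matrix (Fin (d' k)) (Fin d) ℂ) : Prop :=
  ∑ k, (K k)ᴴ * K k = 1

/-- LOCC protocols of two parties holding systems of dimensions `a` and `b`, which end by
announcing an element of `ι`. In each round one party makes a measurement on its own
subsystem, the outcome is communicated, and everything that follows may depend on all the outcomes
obtained so far. There are finitely many rounds, with finitely many outcomes each. The output
space of a measurement operator may have any dimension, so local ancillas and the discarding of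
local subsystems are included. -/
inductive Protocol (ι : Type) : ℕ → ℕ → Type
  | announce {a b : ℕ} (i : ι) : Protocol ι a b
  | alice {a b m : ℕ} (a' : Fin m → ℕ) (K : ∀ k, Matrix (Fin (a' k)) (Fin a) ℂ)
      (hK : IsMeasurement K) (next : ∀ k, Protocol ι (a' k) b) : Protocol ι a b
  | bob {a b m : ℕ} (b' : Fin m → ℕ) (K : ∀ k, Matrix (Fin (b' k)) (Fin b) ℂ)
      (hK : IsMeasurement K) (next : ∀ k, Protocol ι a (b' k)) : Protocol ι a b

/-- `P.weight ψ i` is the probability that the protocol `P`, started in the pure state `ψ`,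
announces `i`; for an unnormalized `ψ` it is this probability times `‖ψ‖ ^ 2`. -/
def Protocol.weight {ι : Type} [DecidableEq ι] :
    {a b : ℕ} → Protocol ι a b → State a b → ι → ℝ
  | _, _, .announce j, ψ, i => if j = i then ‖ψ‖ ^ 2 else 0
  | _, _, .alice _ K _ next, ψ, i => ∑ k, (next k).weight (aliceApply (K k) ψ) i
  | _, _, .bob _ K _ next, ψ, i => ∑ k, (next k).weight (bobApply (K k) ψ) i

/-- The states `S 0, …, S (n - 1)` can be perfectly distinguished by LOCC: some protocol announces
`i` with probability one whenever the given state is `S i`. -/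
def LocallyDistinguishable {a b n : ℕ} (S : Fin n → State a b) : Prop :=
  ∃ P : Protocol (Fin n) a b, ∀ i, P.weight (S i) i = ‖S i‖ ^ 2

/-- A family of nonzero, mutually orthogonal states. -/
def IsOrthogonalSet {a b n : ℕ} (S : Fin n → State a b) : Prop :=
  (∀ i, S i ≠ 0) ∧ ∀ i j, i ≠ j → inner ℂ (S i) (S j) = 0

/-- The measurement `K` of Alice is a nontrivial orthogonality-preserving local measurement (OPLM)
for `S`: for every outcome the post-measurement states are mutually orthogonal (some may vanish),
and not all measurement operators `(K k)† (K k)` are multiples of the identity. -/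
def IsAliceOPLM {a b m n : ℕ} (K : Fin m → Matrix (Fin a) (Fin a) ℂ)
    (S : Fin n → State a b) : Prop :=
  IsMeasurement K ∧
  (∀ k i j, i ≠ j → inner ℂ (aliceApply (K k) (S i)) (aliceApply (K k) (S j)) = 0) ∧
  ¬ ∀ k, ∃ c : ℂ, (K k)ᴴ * K k = c • (1 : Matrix (Fin a) (Fin a) ℂ)

/-- The operator that is left of `|ψ⟩⟨ψ|` when Alice's system is identified with
`ℂ^a₁ ⊗ ℂ^a₂` through `U`, Bob's with `ℂ^b₁ ⊗ ℂ^b₂` through `V`, and the first factor of each is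
traced out. -/
def reducedOp {a b a₁ a₂ b₁ b₂ : ℕ} (U : Matrix (Fin a₁ × Fin a₂) (Fin a) ℂ)
    (V : Matrix (Fin b₁ × Fin b₂) (Fin b) ℂ) (ψ : State a b) :
    Matrix (Fin a₂ × Fin b₂) (Fin a₂ × Fin b₂) ℂ :=
  fun p q => ∑ x : Fin a₁, ∑ y : Fin b₁,
    ((U ⊗ₖ V) *ᵥ ψ.ofLp) ((x, p.1), (y, p.2)) *
      star (((U ⊗ₖ V) *ᵥ ψ.ofLp) ((x, q.1), (y, q.2)))

/-- The set `S` has local redundancy: for some unitary identifications of Alice's system with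
`ℂ^a₁ ⊗ ℂ^a₂` and of Bob's with `ℂ^b₁ ⊗ ℂ^b₂`, the states remain mutually orthogonal after the
first factors, not both of which are trivial, have been discarded. -/
def HasLocalRedundancy {a b n : ℕ} (S : Fin n → State a b) : Prop :=
  ∃ (a₁ a₂ b₁ b₂ : ℕ) (U : Matrix (Fin a₁ × Fin a₂) (Fin a) ℂ)
    (V : Matrix (Fin b₁ × Fin b₂) (Fin b) ℂ),
    Uᴴ * U = 1 ∧ U * Uᴴ = 1 ∧ Vᴴ * V = 1 ∧ V * Vᴴ = 1 ∧ (2 ≤ a₁ ∨ 2 ≤ b₁) ∧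
    ∀ i j, i ≠ j → reducedOp U V (S i) * reducedOp U V (S j) = 0

/-- A (possibly unnormalized) state of `ℂ^d ⊗ ℂ^d` is maximally entangled if it is nonzero and its
reduced operator on Alice's side is a multiple of the identity, necessarily `‖ψ‖ ^ 2 / d`. -/
def IsMaximallyEntangled {d : ℕ} (ψ : State d d) : Prop :=
  ψ ≠ 0 ∧ ∀ i j : Fin d,
    ∑ k, ψ (i, k) * star (ψ (j, k)) = if i = j then ((‖ψ‖ ^ 2 / d : ℝ) : ℂ) else 0

/-- The projector `∑ i ∈ s, |i⟩⟨i|`. -/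
def proj {d : ℕ} (s : Finset (Fin d)) : Matrix (Fin d) (Fin d) ℂ :=
  ∑ i ∈ s, Matrix.single i i 1

/-- The projector `P₀₁` on `ℂ^5`. -/
def P01 : Matrix (Fin 5) (Fin 5) ℂ := proj {0, 1}

/-- The projector `P₂₃₄` on `ℂ^5`. -/
def P234 : Matrix (Fin 5) (Fin 5) ℂ := proj {2, 3, 4}

/-- The three states `φ₁, φ₂, φ₃` of `ℂ^5 ⊗ ℂ^5`. -/
def φ (ω : ℂ) : Fin 3 → State 5 5 :=
  ![ket 0 0 + ket 1 1 + ket 2 2 + ket 3 3 + ket 4 4,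
    ket 0 0 - ket 1 1 - ket 2 2 - ω • ket 3 3 - ω ^ 2 • ket 4 4,
    ket 0 1 + ket 2 3]

/-- The triple `|00⟩ + |11⟩, |00⟩ - |11⟩, |01⟩` of two-qubit states. -/
def qubitTriple : Fin 3 → State 2 2 :=
  ![ket 0 0 + ket 1 1, ket 0 0 - ket 1 1, ket 0 1]

/-- The triple `|00⟩ + |11⟩ + |22⟩, -(|00⟩ + ω|11⟩ + ω²|22⟩), |01⟩` of two-qutrit states. -/
def qutritTriple (ω : ℂ) : Fin 3 → State 3 3 :=
  ![ket 0 0 + ket 1 1 + ket 2 2, -(ket 0 0 + ω • ket 1 1 + ω ^ 2 • ket 2 2), ket 0 1]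

/-- The isometry `ℂ^2 → ℂ^5`, `|i⟩ ↦ |i⟩`. -/
def V01 : Matrix (Fin 5) (Fin 2) ℂ := Matrix.single 0 0 1 + Matrix.single 1 1 1

/-- The isometry `ℂ^3 → ℂ^5`, `|i⟩ ↦ |i + 2⟩`. -/
def V234 : Matrix (Fin 5) (Fin 3) ℂ :=
  Matrix.single 2 0 1 + Matrix.single 3 1 1 + Matrix.single 4 2 1

end LOCC

end

noncomputable section

namespace LOCC

-- Indistinguishability is proved for a larger class than LOCC. Refining every branch of a protocol
-- down to rank one turns it into a complete family of product functionals `α ⊗ β`, each killing all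
-- states but the one it announces (`Protocol.Identifies.separablyDistinguishable`). On both
-- triples, killing `|01⟩` forces `α 0 = 0` or `β 1 = 0`, so one of the diagonal products `α 0 * β
-- 0`, `α 1 * β 1` vanishes. For qubits this leaves no functional able to announce `|00⟩ - |11⟩`.
-- For qutrits, every admissible functional has at least as much weight on the third Fourier state
-- `|00⟩ + ω²|11⟩ + ω|22⟩` as on the first two together, and summation gives `3 + 3 ≤ 3`. Isometries
-- carry both results to `ℂ^5 ⊗ ℂ^5`.
--
-- The original set is distinguishable because Alice can measure in a basis mixing the blocks `{0,
-- 2}` and `{1, 3, 4}`, across the cut of her projectors; each outcome leaves Bob with orthogonal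
-- vectors.
--
-- Redundancy fails because 5 is prime: discarding a nontrivial factor discards a party's whole
-- system, and two maximally entangled states then both reduce to nonzero scalars.

theorem localApply_apply {a b a' b' : ℕ} (A : Matrix (Fin a') (Fin a) ℂ)
    (B : Matrix (Fin b') (Fin b) ℂ) (ψ : State a b) (p : Fin a' × Fin b') :
    localApply A B ψ p = ∑ x, ∑ y, A p.1 x * B p.2 y * ψ (x, y) := by
  simp [localApply, mulVec, dotProduct, kroneckerMap_apply, Fintype.sum_prod_type]

theorem aliceApply_apply {a b a' : ℕ} (K : Matrix (Fin a') (Fin a) ℂ) (ψ : State a b)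
    (p : Fin a' × Fin b) : aliceApply K ψ p = ∑ x, K p.1 x * ψ (x, p.2) := by
  simp [aliceApply, localApply_apply, one_apply]

theorem bobApply_apply {a b b' : ℕ} (K : Matrix (Fin b') (Fin b) ℂ) (ψ : State a b)
    (p : Fin a × Fin b') : bobApply K ψ p = ∑ y, K p.2 y * ψ (p.1, y) := by
  simp [bobApply, localApply_apply, one_apply]

-- Norm conservation under local measurements

theorem norm_sq_toLp_mulVec {m n : Type*} [Fintype m] [Fintype n] (M : Matrix m n ℂ)
    (v : n → ℂ) :
    ((‖(WithLp.toLp 2 (M *ᵥ v) : EuclideanSpace ℂ m)‖ ^ 2 : ℝ) : ℂ) =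
      star v ⬝ᵥ ((Mᴴ * M) *ᵥ v) := by
  rw [← mulVec_mulVec, dotProduct_mulVec, vecMul_conjTranspose, star_star, dotProduct_comm]
  have h := inner_self_eq_norm_sq_to_K (𝕜 := ℂ)
    (WithLp.toLp 2 (M *ᵥ v) : EuclideanSpace ℂ m)
  rw [EuclideanSpace.inner_eq_star_dotProduct] at h
  push_cast
  exact h.symm

/-- Common source for Alice's measurements, Bob's measurements and pairs of local isometries (a
single outcome). -/
theorem sum_norm_sq_localApply {κ : Type*} [Fintype κ] {a b : ℕ} {a' b' : κ → ℕ}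
    (A : ∀ k, Matrix (Fin (a' k)) (Fin a) ℂ) (B : ∀ k, Matrix (Fin (b' k)) (Fin b) ℂ)
    (h : ∑ k, ((A k)ᴴ * A k) ⊗ₖ ((B k)ᴴ * B k) = 1) (ψ : State a b) :
    ∑ k, ‖localApply (A k) (B k) ψ‖ ^ 2 = ‖ψ‖ ^ 2 := by
  have e : ((∑ k, ‖localApply (A k) (B k) ψ‖ ^ 2 : ℝ) : ℂ) = ((‖ψ‖ ^ 2 : ℝ) : ℂ) := by
    have h1 := norm_sq_toLp_mulVec (1 : Matrix (Fin a × Fin b) (Fin a × Fin b) ℂ) ψ.ofLp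
    rw [one_mulVec, conjTranspose_one, one_mul] at h1
    rw [show ψ = WithLp.toLp 2 ψ.ofLp from rfl, h1, ← h, sum_mulVec, dotProduct_sum,
      Complex.ofReal_sum]
    refine Finset.sum_congr rfl fun k _ => ?_
    rw [localApply, norm_sq_toLp_mulVec, conjTranspose_kronecker, ← mul_kronecker_mul]
  exact_mod_cast e

theorem sum_norm_sq_aliceApply {a b m : ℕ} {a' : Fin m → ℕ}
    {K : ∀ k, Matrix (Fin (a' k)) (Fin a) ℂ} (hK : IsMeasurement K) (ψ : State a b) :
    ∑ k, ‖aliceApply (K k) ψ‖ ^ 2 = ‖ψ‖ ^ 2 := by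
  refine sum_norm_sq_localApply K (fun _ => 1) ?_ ψ
  have hK' : ∑ k, (K k)ᴴ * K k = 1 := hK
  simp only [conjTranspose_one, one_mul]
  rw [← one_kronecker_one, ← hK']
  ext p q
  simp [Matrix.sum_apply, kroneckerMap_apply, Finset.sum_mul]

theorem sum_norm_sq_bobApply {a b m : ℕ} {b' : Fin m → ℕ}
    {K : ∀ k, Matrix (Fin (b' k)) (Fin b) ℂ} (hK : IsMeasurement K) (ψ : State a b) :
    ∑ k, ‖bobApply (K k) ψ‖ ^ 2 = ‖ψ‖ ^ 2 := by
  refine sum_norm_sq_localApply (fun _ => 1) K ?_ ψ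
  have hK' : ∑ k, (K k)ᴴ * K k = 1 := hK
  simp only [conjTranspose_one, one_mul]
  rw [← one_kronecker_one, ← hK']
  ext p q
  simp [Matrix.sum_apply, kroneckerMap_apply, Finset.mul_sum]

theorem norm_localApply {a b a' b' : ℕ} {A : Matrix (Fin a') (Fin a) ℂ}
    {B : Matrix (Fin b') (Fin b) ℂ} (hA : Aᴴ * A = 1) (hB : Bᴴ * B = 1) (ψ : State a b) :
    ‖localApply A B ψ‖ ^ 2 = ‖ψ‖ ^ 2 := by
  simpa using sum_norm_sq_localApply (κ := Unit) (fun _ => A) (fun _ => B) (by simp [hA, hB]) ψ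

-- Perfect discrimination as the absence of wrong announcements

namespace Protocol

variable {ι : Type} [DecidableEq ι]

theorem weight_nonneg {a b : ℕ} (P : Protocol ι a b) (ψ : State a b) (i : ι) :
    0 ≤ P.weight ψ i := by
  induction P with
  | announce j => simp only [weight]; split_ifs <;> positivity
  | alice a' K hK next ih => exact Finset.sum_nonneg fun k _ => ih k _
  | bob b' K hK next ih => exact Finset.sum_nonneg fun k _ => ih k _

theorem sum_weight [Fintype ι] {a b : ℕ} (P : Protocol ι a b) (ψ : State a b) :
    ∑ i, P.weight ψ i = ‖ψ‖ ^ 2 := by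
  induction P with
  | announce j => simp [weight]
  | alice a' K hK next ih =>
    simp only [weight]
    rw [Finset.sum_comm, ← sum_norm_sq_aliceApply hK ψ]
    exact Finset.sum_congr rfl fun k _ => ih k _
  | bob b' K hK next ih =>
    simp only [weight]
    rw [Finset.sum_comm, ← sum_norm_sq_bobApply hK ψ]
    exact Finset.sum_congr rfl fun k _ => ih k _

/-- The protocol never announces a wrong index. -/
def Identifies {a b : ℕ} (P : Protocol ι a b) (S : ι → State a b) : Prop :=
  ∀ i j, j ≠ i → P.weight (S i) j = 0

/-- The weights are nonnegative with sum `‖S i‖ ^ 2`, so the right label takes everything exactly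
when the wrong ones take nothing. Unlike the total weight, vanishing passes to each branch
separately. -/
theorem identifies_iff [Fintype ι] {a b : ℕ} (P : Protocol ι a b) (S : ι → State a b) :
    P.Identifies S ↔ ∀ i, P.weight (S i) i = ‖S i‖ ^ 2 := by
  refine forall_congr' fun i => ?_
  rw [← P.sum_weight (S i), ← Finset.add_sum_erase _ _ (Finset.mem_univ i), eq_comm,
    add_eq_left, Finset.sum_eq_zero_iff_of_nonneg fun j _ => P.weight_nonneg _ _]
  simp

theorem identifies_announce {a b : ℕ} {i : ι} {S : ι → State a b} :
    (announce i : Protocol ι a b).Identifies S ↔ ∀ j, j ≠ i → S j = 0 := by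
  simp only [Identifies, weight]
  constructor
  · intro h j hj
    simpa using h j i hj.symm
  · intro h j k hkj
    split_ifs with hik
    · subst hik; simp [h j hkj.symm]
    · rfl

theorem identifies_alice {a b m : ℕ} {a' : Fin m → ℕ} {K : ∀ k, Matrix (Fin (a' k)) (Fin a) ℂ}
    {hK : IsMeasurement K} {next : ∀ k, Protocol ι (a' k) b} {S : ι → State a b} :
    (alice a' K hK next).Identifies S ↔
      ∀ k, (next k).Identifies fun i => aliceApply (K k) (S i) := by
  simp only [Identifies, weight,
    Finset.sum_eq_zero_iff_of_nonneg fun k _ => (next k).weight_nonneg _ _]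
  grind

theorem identifies_bob {a b m : ℕ} {b' : Fin m → ℕ} {K : ∀ k, Matrix (Fin (b' k)) (Fin b) ℂ}
    {hK : IsMeasurement K} {next : ∀ k, Protocol ι a (b' k)} {S : ι → State a b} :
    (bob b' K hK next).Identifies S ↔
      ∀ k, (next k).Identifies fun i => bobApply (K k) (S i) := by
  simp only [Identifies, weight,
    Finset.sum_eq_zero_iff_of_nonneg fun k _ => (next k).weight_nonneg _ _]
  grind

end Protocol

theorem locallyDistinguishable_iff {a b n : ℕ} {S : Fin n → State a b} :
    LocallyDistinguishable S ↔ ∃ P : Protocol (Fin n) a b, P.Identifies S := by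
  simp only [LocallyDistinguishable, Protocol.identifies_iff]

/-- The value of the product functional `α ⊗ β` at `ψ`. -/
def prodForm {a b : ℕ} (α : Fin a → ℂ) (β : Fin b → ℂ) (ψ : State a b) : ℂ :=
  ∑ x, ∑ y, α x * β y * ψ (x, y)

/-- Pulling a product functional back along a local operator keeps it a product; this makes the
induction over protocols possible. -/
theorem prodForm_localApply {a b a' b' : ℕ} (A : Matrix (Fin a') (Fin a) ℂ)
    (B : Matrix (Fin b') (Fin b) ℂ) (α : Fin a' → ℂ) (β : Fin b' → ℂ) (ψ : State a b) :
    prodForm α β (localApply A B ψ) = prodForm (α ᵥ* A) (β ᵥ* B) ψ := by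
  have e (x : Fin a) (y : Fin b) : (α ᵥ* A) x * (β ᵥ* B) y =
      ∑ p : Fin a' × Fin b', α p.1 * β p.2 * (A p.1 x * B p.2 y) := by
    rw [vecMul, vecMul, dotProduct, dotProduct, Fintype.sum_mul_sum, Fintype.sum_prod_type]
    exact Finset.sum_congr rfl fun _ _ => Finset.sum_congr rfl fun _ _ => by ring
  simp only [prodForm, e, localApply_apply, ← Fintype.sum_prod_type', Finset.mul_sum,
    Finset.sum_mul]
  -- Both sides are the same fourfold sum; the equivalence swaps the input pair of indices with the
  -- output pair.
  exact Fintype.sum_equiv ⟨fun p => (p.2.2.1, p.2.2.2, p.1, p.2.1),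
    fun p => (p.2.2.1, p.2.2.2, p.1, p.2.1), fun _ => rfl, fun _ => rfl⟩ _ _ fun _ => by
      simp only [Equiv.coe_fn_mk]; ring

/-- Perfect discrimination by a measurement consisting of rank one product operators. -/
def SeparablyDistinguishable {ι : Type} {a b : ℕ} (S : ι → State a b) : Prop :=
  ∃ (L : Type) (_ : Fintype L) (label : L → ι) (α : L → Fin a → ℂ) (β : L → Fin b → ℂ),
    (∀ ψ : State a b, ∑ l, ‖prodForm (α l) (β l) ψ‖ ^ 2 = ‖ψ‖ ^ 2) ∧
    ∀ l j, j ≠ label l → prodForm (α l) (β l) (S j) = 0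

/-- Concatenation: an outcome is a branch `k` followed by an outcome of the measurement chosen
there, with its functional pulled back. -/
theorem SeparablyDistinguishable.of_localApply {ι : Type} {a b m : ℕ} {a' b' : Fin m → ℕ}
    {A : ∀ k, Matrix (Fin (a' k)) (Fin a) ℂ} {B : ∀ k, Matrix (Fin (b' k)) (Fin b) ℂ}
    (h : ∀ ψ : State a b, ∑ k, ‖localApply (A k) (B k) ψ‖ ^ 2 = ‖ψ‖ ^ 2) {S : ι → State a b}
    (hS : ∀ k, SeparablyDistinguishable fun i => localApply (A k) (B k) (S i)) :
    SeparablyDistinguishable S := by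
  choose L hL label α β h1 h2 using hS
  refine ⟨Σ k, L k, inferInstance, fun l => label l.1 l.2, fun l => α l.1 l.2 ᵥ* A l.1,
    fun l => β l.1 l.2 ᵥ* B l.1, fun ψ => ?_, fun l j hj => ?_⟩
  · rw [← h ψ, Fintype.sum_sigma]
    refine Finset.sum_congr rfl fun k _ => ?_
    rw [← h1 k]
    simp only [prodForm_localApply]
  · rw [← prodForm_localApply]
    exact h2 l.1 l.2 j hj

theorem SeparablyDistinguishable.of_isometry {ι : Type} {a b a' b' : ℕ}
    {A : Matrix (Fin a') (Fin a) ℂ} {B : Matrix (Fin b') (Fin b) ℂ} (hA : Aᴴ * A = 1)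
    (hB : Bᴴ * B = 1) {S : ι → State a b}
    (hS : SeparablyDistinguishable fun i => localApply A B (S i)) :
    SeparablyDistinguishable S :=
  SeparablyDistinguishable.of_localApply (m := 1) (A := fun _ => A) (B := fun _ => B)
    (fun ψ => by simp [norm_localApply hA hB]) fun _ => hS

theorem Protocol.Identifies.separablyDistinguishable {ι : Type} [DecidableEq ι] {a b : ℕ}
    {P : Protocol ι a b} {S : ι → State a b} (h : P.Identifies S) :
    SeparablyDistinguishable S := by
  induction P with
  | @announce a b i =>
    rw [identifies_announce] at h
    -- At a leaf, measure in the product basis and give every outcome the announced label.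
    refine ⟨Fin a × Fin b, inferInstance, fun _ => i, fun l => Pi.single l.1 1,
      fun l => Pi.single l.2 1, fun ψ => ?_, fun l j hj => ?_⟩
    · rw [EuclideanSpace.norm_sq_eq]
      refine Finset.sum_congr rfl fun l _ => ?_
      simp [prodForm, Pi.single_apply]
    · simp [prodForm, h j hj]
  | alice a' K hK next ih =>
    rw [identifies_alice] at h
    exact .of_localApply (sum_norm_sq_aliceApply hK) fun k => ih k (h k)
  | bob b' K hK next ih =>
    rw [identifies_bob] at h
    exact .of_localApply (sum_norm_sq_bobApply hK) fun k => ih k (h k)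

theorem LocallyDistinguishable.separablyDistinguishable {a b n : ℕ} {S : Fin n → State a b}
    (h : LocallyDistinguishable S) : SeparablyDistinguishable S :=
  let ⟨_, hP⟩ := locallyDistinguishable_iff.1 h
  hP.separablyDistinguishable

theorem ket_apply {a b : ℕ} (i : Fin a) (j : Fin b) (p : Fin a × Fin b) :
    ket i j p = if p.1 = i ∧ p.2 = j then 1 else 0 := by
  simp [ket, Prod.ext_iff]

theorem prodForm_add {a b : ℕ} (α : Fin a → ℂ) (β : Fin b → ℂ) (ψ χ : State a b) :
    prodForm α β (ψ + χ) = prodForm α β ψ + prodForm α β χ := by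
  simp [prodForm, mul_add, Finset.sum_add_distrib]

theorem prodForm_smul {a b : ℕ} (α : Fin a → ℂ) (β : Fin b → ℂ) (c : ℂ) (ψ : State a b) :
    prodForm α β (c • ψ) = c * prodForm α β ψ := by
  simp only [prodForm, PiLp.smul_apply, smul_eq_mul, Finset.mul_sum]
  exact Finset.sum_congr rfl fun _ _ => Finset.sum_congr rfl fun _ _ => by ring

theorem prodForm_neg {a b : ℕ} (α : Fin a → ℂ) (β : Fin b → ℂ) (ψ : State a b) :
    prodForm α β (-ψ) = -prodForm α β ψ := by
  simpa using prodForm_smul α β (-1) ψ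

theorem prodForm_sub {a b : ℕ} (α : Fin a → ℂ) (β : Fin b → ℂ) (ψ χ : State a b) :
    prodForm α β (ψ - χ) = prodForm α β ψ - prodForm α β χ := by
  rw [sub_eq_add_neg, prodForm_add, prodForm_neg, sub_eq_add_neg]

theorem prodForm_ket {a b : ℕ} (α : Fin a → ℂ) (β : Fin b → ℂ) (i : Fin a) (j : Fin b) :
    prodForm α β (ket i j) = α i * β j := by
  simp [prodForm, ket_apply, ite_and]

theorem norm_sq_state {a b : ℕ} (ψ : State a b) : ‖ψ‖ ^ 2 = ∑ i, ∑ j, ‖ψ (i, j)‖ ^ 2 := by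
  rw [EuclideanSpace.norm_sq_eq, Fintype.sum_prod_type]

theorem inner_state {a b : ℕ} (ψ χ : State a b) :
    inner ℂ ψ χ = ∑ i, ∑ j, star (ψ (i, j)) * χ (i, j) := by
  rw [PiLp.inner_apply, Fintype.sum_prod_type]
  simp [mul_comm]

-- Impossibility for the qubit and qutrit triples

theorem not_separablyDistinguishable_qubitTriple :
    ¬ SeparablyDistinguishable qubitTriple := by
  rintro ⟨L, hL, label, α, β, h1, h2⟩
  have h0 (l : L) : prodForm (α l) (β l) (qubitTriple 1) = 0 := by
    by_contra hne
    have hl : label l = 1 := by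
      by_contra h
      exact hne (h2 l 1 (Ne.symm h))
    have e0 := h2 l 0 (by simp [hl])
    have e2 := h2 l 2 (by simp [hl])
    apply hne
    simp only [qubitTriple, cons_val, prodForm_add, prodForm_sub, prodForm_ket] at e0 e2 ⊢
    -- Either factor being zero kills one diagonal product; `e0` then kills the other.
    rcases mul_eq_zero.1 e2 with h | h <;> simp_all
  -- Completeness now makes a state of squared norm 2 have norm zero.
  have h := h1 (qubitTriple 1)
  simp only [h0] at h
  norm_num [norm_sq_state, Fin.sum_univ_succ, qubitTriple, ket_apply] at h

section

variable {ω : ℂ} (hω : IsPrimitiveRoot ω 3)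
include hω

theorem one_add_add_sq_eq_zero : 1 + ω + ω ^ 2 = 0 := by
  simpa [Finset.sum_range_succ] using hω.geom_sum_eq_zero (by norm_num)

theorem norm_primitiveRoot : ‖ω‖ = 1 := hω.norm'_eq_one (by norm_num)

theorem star_primitiveRoot : (starRingEnd ℂ) ω = ω ^ 2 := by
  have h := Complex.mul_conj' ω
  rw [norm_primitiveRoot hω] at h
  have h3 := hω.pow_eq_one
  have h0 := hω.ne_zero (by norm_num)
  apply mul_left_cancel₀ h0
  rw [h, ← pow_succ', h3]; simp

/-- For label 0 or 1, one of the two Fourier sums of the diagonal products is zero and so is one of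
the first two products. The surviving pair is then fixed up to scale, and the two remaining Fourier
sums differ by a factor `c` of modulus one. For label 2 the left side is zero. -/
theorem prodForm_qutritTriple_le (α β : Fin 3 → ℂ) (i : Fin 3)
    (h : ∀ j, j ≠ i → prodForm α β (qutritTriple ω j) = 0) :
    ‖prodForm α β (qutritTriple ω 0)‖ ^ 2 + ‖prodForm α β (qutritTriple ω 1)‖ ^ 2 ≤
      ‖prodForm α β (ket 0 0 + ω ^ 2 • ket 1 1 + ω • ket 2 2)‖ ^ 2 := by
  have h3 := hω.pow_eq_one
  have hs := one_add_add_sq_eq_zero hω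
  have hn := norm_primitiveRoot hω
  have key {x y c : ℂ} (hc : ‖c‖ = 1) (hxy : x = c * y) : ‖x‖ ^ 2 ≤ ‖y‖ ^ 2 := by
    simp [hxy, hc]
  have e0 := h 0
  have e1 := h 1
  have e2 := h 2
  simp only [qutritTriple, cons_val, prodForm_add, prodForm_neg, prodForm_smul, prodForm_ket]
    at e0 e1 e2 ⊢
  fin_cases i
  · replace e1 := e1 (by decide)
    have hu := mul_eq_zero.1 (e2 (by decide))
    rw [e1]
    simp only [norm_zero, ne_eq, OfNat.ofNat_ne_zero, not_false_eq_true, zero_pow, add_zero]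
    rcases hu with hu | hu
    · refine key (c := -1) (by simp) ?_
      simp only [hu] at e1 ⊢
      linear_combination (α 1 * β 1 + α 2 * β 2) * hs + e1
    · refine key (c := -ω) (by simp [hn]) ?_
      simp only [hu] at e1 ⊢
      linear_combination (α 0 * β 0 + α 2 * β 2) * hs + ω ^ 2 * e1 + ω * (α 2 * β 2) * h3
  · replace e0 := e0 (by decide)
    have hu := mul_eq_zero.1 (e2 (by decide))
    rw [e0]
    simp only [norm_zero, ne_eq, OfNat.ofNat_ne_zero, not_false_eq_true, zero_pow, zero_add]
    rcases hu with hu | hu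
    · refine key (c := 1) (by simp) ?_
      simp only [hu] at e0 ⊢
      linear_combination e0 - (α 1 * β 1 + α 2 * β 2) * hs
    · refine key (c := ω ^ 2) (by simp [hn]) ?_
      simp only [hu] at e0 ⊢
      linear_combination ω * e0 - (α 0 * β 0 + ω * (α 2 * β 2)) * hs
  · rw [e0 (by decide), e1 (by decide)]
    simp

theorem not_separablyDistinguishable_qutritTriple :
    ¬ SeparablyDistinguishable (qutritTriple ω) := by
  rintro ⟨L, hL, label, α, β, h1, h2⟩
  have h := Finset.sum_le_sum fun l (_ : l ∈ Finset.univ) =>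
    prodForm_qutritTriple_le hω (α l) (β l) (label l) (h2 l)
  -- Completeness turns the three sums into squared norms, each equal to 3.
  rw [Finset.sum_add_distrib, h1, h1, h1] at h
  simp [norm_sq_state, Fin.sum_univ_succ, qutritTriple, ket_apply, norm_primitiveRoot hω] at h
  norm_num at h

end

-- One-way protocols: Alice measures a basis, Bob discriminates

/-- The orthogonal projection onto the line spanned by `v` (zero for `v = 0`). -/
def lineProj {b : ℕ} (v : Fin b → ℂ) : Matrix (Fin b) (Fin b) ℂ :=
  (star v ⬝ᵥ v)⁻¹ • vecMulVec v (star v)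

theorem lineProj_mulVec_of_orthogonal {b : ℕ} {v w : Fin b → ℂ} (h : star v ⬝ᵥ w = 0) :
    lineProj v *ᵥ w = 0 := by
  simp [lineProj, smul_mulVec, vecMulVec_mulVec, h]

open scoped ComplexOrder in
theorem lineProj_mulVec_self {b : ℕ} (v : Fin b → ℂ) : lineProj v *ᵥ v = v := by
  by_cases h : star v ⬝ᵥ v = 0
  · rw [dotProduct_star_self_eq_zero.1 h]; simp
  · simp [lineProj, smul_mulVec, vecMulVec_mulVec, smul_smul, h]

theorem conjTranspose_lineProj {b : ℕ} (v : Fin b → ℂ) : (lineProj v)ᴴ = lineProj v := by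
  have h : star (star v ⬝ᵥ v) = star v ⬝ᵥ v := by rw [← star_dotProduct_star, star_star]
  simp [lineProj, conjTranspose_smul, conjTranspose_vecMulVec, h]

theorem lineProj_mul_self {b : ℕ} (v : Fin b → ℂ) : lineProj v * lineProj v = lineProj v := by
  rw [lineProj, mul_smul_comm, ← lineProj, mul_vecMulVec, lineProj_mulVec_self, lineProj]

/-- Bob can identify mutually orthogonal states of his own system. -/
theorem exists_identifies_of_orthogonal {b n : ℕ} [NeZero n] (S : Fin n → State 1 b)
    (h : ∀ i j, i ≠ j → inner ℂ (S i) (S j) = 0) :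
    ∃ P : Protocol (Fin n) 1 b, P.Identifies S := by
  set v : Fin n → Fin b → ℂ := fun i y => S i (0, y) with hv
  have ho i j (hij : i ≠ j) : star (v i) ⬝ᵥ v j = 0 := by
    simpa [inner_state, dotProduct, hv] using h i j hij
  set Q : Matrix (Fin b) (Fin b) ℂ := ∑ i, lineProj (v i) with hQ
  have hQH : Qᴴ = Q := by simp [hQ, conjTranspose_sum, conjTranspose_lineProj]
  have hQv i : Q *ᵥ v i = v i := by
    rw [hQ, sum_mulVec, Finset.sum_eq_single i, lineProj_mulVec_self]
    · exact fun j _ hj => lineProj_mulVec_of_orthogonal (ho j i hj)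
    · simp
  have hQQ : Q * Q = Q := by
    conv_rhs => rw [hQ]
    nth_rw 2 [hQ]
    rw [Finset.mul_sum]
    refine Finset.sum_congr rfl fun i _ => ?_
    rw [lineProj, mul_smul_comm, mul_vecMulVec, hQv]
  -- Outcome 0 completes the measurement on the complement of the span of the `v i`.
  let K : Fin (n + 1) → Matrix (Fin b) (Fin b) ℂ := Fin.cons (1 - Q) fun i => lineProj (v i)
  have hK : IsMeasurement K := by
    simp only [IsMeasurement, Fin.sum_univ_succ, K, Fin.cons_zero, Fin.cons_succ,
      conjTranspose_sub, conjTranspose_one, hQH, conjTranspose_lineProj, lineProj_mul_self, ← hQ]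
    simp [sub_mul, mul_sub, hQQ]
  have hb {T : Matrix (Fin b) (Fin b) ℂ} {j : Fin n} (hT : T *ᵥ v j = 0) :
      bobApply T (S j) = 0 := by
    ext ⟨x, y⟩
    rw [bobApply_apply, Subsingleton.elim x 0]
    exact congrFun hT y
  -- The complementary outcome never occurs on the given states, so its label 0 is arbitrary.
  refine ⟨.bob _ K hK (Fin.cons (.announce 0) fun i => .announce i), ?_⟩
  rw [Protocol.identifies_bob]
  refine Fin.cases ?_ fun i => ?_
  · rw [Fin.cons_zero, Protocol.identifies_announce]
    exact fun j _ => hb (by simp [K, sub_mulVec, hQv])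
  · rw [Fin.cons_succ, Protocol.identifies_announce]
    exact fun j hj => hb (lineProj_mulVec_of_orthogonal (ho i j hj.symm))

/-- If Alice can measure in an orthonormal basis such that for each outcome Bob is left with
mutually orthogonal states, then the family is locally distinguishable. -/
theorem locallyDistinguishable_of_unitary {a b n : ℕ} [NeZero n] {S : Fin n → State a b}
    (U : Matrix (Fin a) (Fin a) ℂ) (hU : Uᴴ * U = 1)
    (h : ∀ k i j, i ≠ j →
      ∑ y, star (∑ x, U k x * S i (x, y)) * ∑ x, U k x * S j (x, y) = 0) :
    LocallyDistinguishable S := by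
  have hK : IsMeasurement (d' := fun _ => 1) fun k => replicateRow (Fin 1) (U k) := by
    refine Eq.trans ?_ hU
    ext p q
    rw [Matrix.sum_apply]
    simp [mul_apply]
  have hn k := exists_identifies_of_orthogonal
    (fun i => aliceApply (replicateRow (Fin 1) (U k)) (S i)) fun i j hij => by
      simp only [inner_state, Fin.sum_univ_one, aliceApply_apply, replicateRow_apply]
      exact h k i j hij
  choose P hP using hn
  exact locallyDistinguishable_iff.2 ⟨.alice _ _ hK P, Protocol.identifies_alice.2 hP⟩

-- Absence of local redundancy

/-- The state `∑ i, d i |i i⟩`. -/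
def diagState {a : ℕ} (d : Fin a → ℂ) : State a a :=
  WithLp.toLp 2 fun p => if p.1 = p.2 then d p.1 else 0

theorem kronecker_mulVec_diagState {a : ℕ} {m n : Type*} [Fintype m] [Fintype n]
    (U : Matrix m (Fin a) ℂ) (V : Matrix n (Fin a) ℂ) (d : Fin a → ℂ) (p : m × n) :
    ((U ⊗ₖ V) *ᵥ (diagState d).ofLp) p = (U * diagonal d * Vᵀ) p.1 p.2 := by
  simp [mulVec, dotProduct, Fintype.sum_prod_type, diagState, kroneckerMap_apply, mul_apply,
    diagonal_apply]
  exact Finset.sum_congr rfl fun _ _ => by ring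

theorem diagonal_mul_conjTranspose_self {a : ℕ} {d : Fin a → ℂ} (hd : ∀ i, ‖d i‖ = 1) :
    diagonal d * (diagonal d)ᴴ = 1 := by
  rw [diagonal_conjTranspose, diagonal_mul_diagonal, ← diagonal_one]
  congr 1; ext i
  simp [Complex.mul_conj', hd]

section Redundancy

variable {a a₁ a₂ b₁ b₂ : ℕ} {U : Matrix (Fin a₁ × Fin a₂) (Fin a) ℂ}
  {V : Matrix (Fin b₁ × Fin b₂) (Fin a) ℂ} {d : Fin a → ℂ}

/-- With `a₂ = 1` all of Alice's system is traced out. The coefficient matrix `U * diagonal d * Vᵀ`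
has orthonormal columns, so Bob is left with the identity, whose partial trace over his first factor
is `b₁ • 1`. -/
theorem reducedOp_diagState_of_alice (hU : Uᴴ * U = 1) (hV : V * Vᴴ = 1) (hd : ∀ i, ‖d i‖ = 1)
    (h : a₂ = 1) : reducedOp U V (diagState d) = (b₁ : ℂ) • 1 := by
  subst h
  have e : (U * diagonal d * Vᵀ)ᵀ * ((U * diagonal d * Vᵀ)ᵀ)ᴴ = 1 := by
    have hUt : Uᵀ * Uᵀᴴ = 1 := by
      have := congrArg transpose hU
      rw [transpose_mul, transpose_one] at this
      rw [← this]; rfl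
    calc _ = V * diagonal d * (Uᵀ * Uᵀᴴ) * (diagonal d)ᴴ * Vᴴ := by
          simp [Matrix.mul_assoc]
      _ = 1 := by
          rw [hUt, Matrix.mul_one, Matrix.mul_assoc V, diagonal_mul_conjTranspose_self hd,
            Matrix.mul_one, hV]
  ext ⟨p, p'⟩ ⟨q, q'⟩
  rw [Subsingleton.elim q p, Subsingleton.elim p 0]
  simp only [reducedOp, kronecker_mulVec_diagState]
  rw [Finset.sum_comm]
  trans ∑ y : Fin b₁, (1 : Matrix (Fin b₁ × Fin b₂) (Fin b₁ × Fin b₂) ℂ) (y, p') (y, q')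
  · refine Finset.sum_congr rfl fun y _ => ?_
    rw [← e, mul_apply, Fintype.sum_prod_type]
    simp only [Fin.sum_univ_one, Fin.isValue, transpose_apply, conjTranspose_apply]
  · simp [one_apply]

theorem reducedOp_diagState_of_bob (hV : Vᴴ * V = 1) (hU : U * Uᴴ = 1) (hd : ∀ i, ‖d i‖ = 1)
    (h : b₂ = 1) : reducedOp U V (diagState d) = (a₁ : ℂ) • 1 := by
  subst h
  have e : (U * diagonal d * Vᵀ) * (U * diagonal d * Vᵀ)ᴴ = 1 := by
    have hVt : Vᵀ * Vᵀᴴ = 1 := by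
      have := congrArg transpose hV
      rw [transpose_mul, transpose_one] at this
      rw [← this]; rfl
    calc _ = U * diagonal d * (Vᵀ * Vᵀᴴ) * (diagonal d)ᴴ * Uᴴ := by
          simp [Matrix.mul_assoc]
      _ = 1 := by
          rw [hVt, Matrix.mul_one, Matrix.mul_assoc U, diagonal_mul_conjTranspose_self hd,
            Matrix.mul_one, hU]
  ext ⟨p, p'⟩ ⟨q, q'⟩
  rw [Subsingleton.elim q' p', Subsingleton.elim p' 0]
  simp only [reducedOp, kronecker_mulVec_diagState]
  trans ∑ y : Fin a₁, (1 : Matrix (Fin a₁ × Fin a₂) (Fin a₁ × Fin a₂) ℂ) (y, p) (y, q)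
  · refine Finset.sum_congr rfl fun y _ => ?_
    rw [← e, mul_apply, Fintype.sum_prod_type]
    simp only [Fin.sum_univ_one, Fin.isValue, conjTranspose_apply]
  · simp [one_apply]

end Redundancy

/-- Compare the traces of `Uᴴ * U` and `U * Uᴴ`. -/
theorem mul_eq_of_unitary {a a₁ a₂ : ℕ} {U : Matrix (Fin a₁ × Fin a₂) (Fin a) ℂ}
    (h1 : Uᴴ * U = 1) (h2 : U * Uᴴ = 1) : a₁ * a₂ = a := by
  have h := trace_mul_comm Uᴴ U
  rw [h1, h2, trace_one, trace_one] at h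
  simp only [Fintype.card_prod, Fintype.card_fin] at h
  exact_mod_cast h.symm

/-- In prime dimension, a family with two diagonal states that have coefficients of modulus one
has no local redundancy. -/
theorem not_hasLocalRedundancy {a n : ℕ} (ha : a.Prime) {S : Fin n → State a a} {i j : Fin n}
    (hij : i ≠ j) {d e : Fin a → ℂ} (hd : ∀ x, ‖d x‖ = 1) (he : ∀ x, ‖e x‖ = 1)
    (hi : S i = diagState d) (hj : S j = diagState e) : ¬ HasLocalRedundancy S := by
  rintro ⟨a₁, a₂, b₁, b₂, U, V, hU, hU', hV, hV', h2, h⟩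
  have hA := mul_eq_of_unitary hU hU'
  have hB := mul_eq_of_unitary hV hV'
  have h0 := ha.ne_zero
  have hA1 : a₁ ≠ 0 := by rintro rfl; simp at hA; omega
  have hA2 : a₂ ≠ 0 := by rintro rfl; simp at hA; omega
  have hB1 : b₁ ≠ 0 := by rintro rfl; simp at hB; omega
  have hB2 : b₂ ≠ 0 := by rintro rfl; simp at hB; omega
  have : NeZero a₂ := ⟨hA2⟩
  have : NeZero b₂ := ⟨hB2⟩
  specialize h i j hij
  rw [hi, hj] at h
  have key {c : ℕ} (hc : c ≠ 0) (h : ((c : ℂ) • (1 : Matrix (Fin a₂ × Fin b₂)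
      (Fin a₂ × Fin b₂) ℂ)) * ((c : ℂ) • 1) = 0) : False := by
    have h' := congrFun (congrFun h (0, 0)) (0, 0)
    simp [hc] at h'
  have hp {x y : ℕ} (hx : 2 ≤ x) (hxy : x * y = a) : y = 1 := by
    rcases Nat.prime_mul_iff.1 (hxy ▸ ha) with h | h
    · exact h.2
    · omega
  rcases h2 with h2 | h2
  · have h1 := hp h2 hA
    rw [reducedOp_diagState_of_alice hU hV' hd h1, reducedOp_diagState_of_alice hU hV' he h1] at h
    exact key hB1 h
  · have h1 := hp h2 hB
    rw [reducedOp_diagState_of_bob hV hU' hd h1, reducedOp_diagState_of_bob hV hU' he h1] at h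
    exact key hA1 h

-- Alice's projectors, the post-measurement states and their embeddings

theorem proj_eq_diagonal {d : ℕ} (s : Finset (Fin d)) :
    proj s = diagonal fun i => if i ∈ s then 1 else 0 := by
  ext i j
  rw [proj, Matrix.sum_apply]
  simp only [single_apply, diagonal_apply]
  by_cases h : i = j
  · subst h; simp
  · have : ∀ c, ¬ (c = i ∧ c = j) := fun c hc => h (hc.1.symm.trans hc.2)
    simp [h, this]

theorem aliceApply_proj_apply {d b : ℕ} (s : Finset (Fin d)) (ψ : State d b)
    (p : Fin d × Fin b) : aliceApply (proj s) ψ p = if p.1 ∈ s then ψ p else 0 := by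
  simp [aliceApply_apply, proj_eq_diagonal, diagonal_apply]

theorem isStarProjection_proj {d : ℕ} (s : Finset (Fin d)) : IsStarProjection (proj s) := by
  rw [proj_eq_diagonal]
  constructor
  · rw [IsIdempotentElem, diagonal_mul_diagonal]
    congr 1; ext i; simp
  · rw [isSelfAdjoint_iff, star_eq_conjTranspose, diagonal_conjTranspose]
    congr 1; ext i; simp [apply_ite]

theorem P01_mul_P234 : P01 * P234 = 0 := by
  rw [P01, P234, proj_eq_diagonal, proj_eq_diagonal, diagonal_mul_diagonal, ← diagonal_zero]
  congr 1; ext i; fin_cases i <;> simp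

theorem isMeasurement_P01_P234 : IsMeasurement (d' := fun _ => 5) ![P01, P234] := by
  have h (s : Finset (Fin 5)) : (proj s)ᴴ * proj s = proj s := by
    have hs := isStarProjection_proj s
    rw [← star_eq_conjTranspose, hs.isSelfAdjoint.star_eq, hs.isIdempotentElem.eq]
  simp only [IsMeasurement, Fin.sum_univ_two, cons_val_zero, cons_val_one]
  rw [P01, P234, h, h, proj_eq_diagonal, proj_eq_diagonal, diagonal_add, ← diagonal_one]
  congr 1; ext i; fin_cases i <;> simp

theorem P01_not_scalar (c : ℂ) : P01ᴴ * P01 ≠ c • (1 : Matrix (Fin 5) (Fin 5) ℂ) := by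
  intro h
  rw [P01, proj_eq_diagonal, diagonal_conjTranspose, diagonal_mul_diagonal] at h
  have h0 := congrFun (congrFun h 0) 0
  have h4 := congrFun (congrFun h 4) 4
  simp at h0 h4
  rw [← h4] at h0
  simp at h0

theorem V01_isometry : V01ᴴ * V01 = 1 := by
  ext i j
  fin_cases i <;> fin_cases j <;> simp [V01, mul_apply, single_apply]

theorem V234_isometry : V234ᴴ * V234 = 1 := by
  ext i j
  fin_cases i <;> fin_cases j <;> simp [V234, mul_apply, single_apply]

theorem localApply_add {a b a' b' : ℕ} (A : Matrix (Fin a') (Fin a) ℂ)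
    (B : Matrix (Fin b') (Fin b) ℂ) (ψ χ : State a b) :
    localApply A B (ψ + χ) = localApply A B ψ + localApply A B χ := by
  simp [localApply, mulVec_add]

theorem localApply_smul {a b a' b' : ℕ} (A : Matrix (Fin a') (Fin a) ℂ)
    (B : Matrix (Fin b') (Fin b) ℂ) (c : ℂ) (ψ : State a b) :
    localApply A B (c • ψ) = c • localApply A B ψ := by
  simp [localApply, mulVec_smul]

theorem localApply_neg {a b a' b' : ℕ} (A : Matrix (Fin a') (Fin a) ℂ)
    (B : Matrix (Fin b') (Fin b) ℂ) (ψ : State a b) :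
    localApply A B (-ψ) = -localApply A B ψ := by
  simp [localApply, mulVec_neg]

theorem localApply_sub {a b a' b' : ℕ} (A : Matrix (Fin a') (Fin a) ℂ)
    (B : Matrix (Fin b') (Fin b) ℂ) (ψ χ : State a b) :
    localApply A B (ψ - χ) = localApply A B ψ - localApply A B χ := by
  simp [localApply, mulVec_sub]

theorem localApply_ket {a b a' b' : ℕ} {A : Matrix (Fin a') (Fin a) ℂ}
    {B : Matrix (Fin b') (Fin b) ℂ} {i : Fin a} {j : Fin b} {i' : Fin a'} {j' : Fin b'}
    (hA : A.col i = Pi.single i' 1) (hB : B.col j = Pi.single j' 1) :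
    localApply A B (ket i j) = ket i' j' := by
  ext ⟨x, y⟩
  have hA' := congrFun hA x
  have hB' := congrFun hB y
  simp only [col_apply] at hA' hB'
  simp [localApply_apply, ket_apply, ite_and, hA', hB', Pi.single_apply]
  grind

theorem localApply_V01_ket (i j : Fin 2) :
    localApply V01 V01 (ket i j) = ket (Fin.castLE (by decide) i) (Fin.castLE (by decide) j) := by
  have h (i : Fin 2) : V01.col i = Pi.single (Fin.castLE (by decide) i) 1 := by
    ext x; fin_cases i <;> fin_cases x <;> simp [V01]
  exact localApply_ket (h i) (h j)

theorem localApply_V234_ket (i j : Fin 3) :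
    localApply V234 V234 (ket i j) = ket (Fin.natAdd 2 i) (Fin.natAdd 2 j) := by
  have h (i : Fin 3) : V234.col i = Pi.single (Fin.natAdd 2 i) 1 := by
    ext x; fin_cases i <;> fin_cases x <;> simp [V234]
  exact localApply_ket (h i) (h j)

theorem aliceApply_proj_ket {d b : ℕ} (s : Finset (Fin d)) (i : Fin d) (j : Fin b) :
    aliceApply (proj s) (ket i j) = if i ∈ s then ket i j else 0 := by
  ext ⟨x, y⟩
  rw [aliceApply_proj_apply]
  by_cases h : x = i
  · subst h; split_ifs <;> rfl
  · split_ifs <;> simp [ket_apply, h]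

theorem aliceApply_P01_φ (ω : ℂ) (i : Fin 3) : aliceApply P01 (φ ω i) =
    (![ket 0 0 + ket 1 1, ket 0 0 - ket 1 1, ket 0 1] : Fin 3 → State 5 5) i := by
  have h (i j : Fin 5) := aliceApply_proj_ket {0, 1} i j
  simp only [aliceApply] at h ⊢
  fin_cases i <;>
    simp [φ, P01, localApply_add, localApply_sub, localApply_smul, h]

theorem aliceApply_P234_φ (ω : ℂ) (i : Fin 3) : aliceApply P234 (φ ω i) =
    (![ket 2 2 + ket 3 3 + ket 4 4, -(ket 2 2 + ω • ket 3 3 + ω ^ 2 • ket 4 4), ket 2 3] :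
      Fin 3 → State 5 5) i := by
  have h (i j : Fin 5) := aliceApply_proj_ket {2, 3, 4} i j
  simp only [aliceApply] at h ⊢
  fin_cases i <;>
    simp [φ, P234, localApply_add, localApply_sub, localApply_smul, h]
  abel

theorem aliceApply_P01_φ_eq_localApply (ω : ℂ) (i : Fin 3) :
    aliceApply P01 (φ ω i) = localApply V01 V01 (qubitTriple i) := by
  rw [aliceApply_P01_φ]
  fin_cases i <;>
    simp [qubitTriple, localApply_add, localApply_sub, localApply_V01_ket]

theorem aliceApply_P234_φ_eq_localApply (ω : ℂ) (i : Fin 3) :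
    aliceApply P234 (φ ω i) = localApply V234 V234 (qutritTriple ω i) := by
  rw [aliceApply_P234_φ]
  fin_cases i <;>
    simp [qutritTriple, localApply_add, localApply_neg, localApply_smul, localApply_V234_ket]

/-- The five coefficients of the second state. -/
def φDiag (ω : ℂ) : Fin 5 → ℂ := ![1, -1, -1, -ω, -ω ^ 2]

theorem φ_zero_eq (ω : ℂ) : φ ω 0 = diagState 1 := by
  ext ⟨x, y⟩
  fin_cases x <;> fin_cases y <;> simp [φ, diagState, ket_apply]

theorem φ_one_eq (ω : ℂ) : φ ω 1 = diagState (φDiag ω) := by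
  ext ⟨x, y⟩
  fin_cases x <;> fin_cases y <;> simp [φ, diagState, ket_apply, φDiag]

theorem ne_zero_of_apply {a b : ℕ} {ψ : State a b} (p : Fin a × Fin b) (h : ψ p ≠ 0) : ψ ≠ 0 := by
  rintro rfl; exact h rfl

theorem norm_sq_diagState {a : ℕ} {d : Fin a → ℂ} (hd : ∀ i, ‖d i‖ = 1) :
    ‖diagState d‖ ^ 2 = a := by
  simp [norm_sq_state, diagState, apply_ite, hd]

theorem isMaximallyEntangled_diagState {a : ℕ} [NeZero a] {d : Fin a → ℂ}
    (hd : ∀ i, ‖d i‖ = 1) : IsMaximallyEntangled (diagState d) := by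
  refine ⟨fun h => ?_, fun i j => ?_⟩
  · have h' := norm_sq_diagState hd
    rw [h] at h'
    simp [eq_comm, NeZero.ne a] at h'
  · rw [norm_sq_diagState hd]
    split_ifs with hij
    · subst hij
      simp [diagState, apply_ite, Complex.mul_conj', hd]
    · simp [diagState, apply_ite, hij]

theorem isMaximallyEntangled_qutritTriple_zero (ω : ℂ) :
    IsMaximallyEntangled (qutritTriple ω 0) := by
  have h : qutritTriple ω 0 = diagState 1 := by
    ext ⟨x, y⟩
    fin_cases x <;> fin_cases y <;> simp [qutritTriple, diagState, ket_apply]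
  rw [h]
  exact isMaximallyEntangled_diagState (by simp)

theorem norm_ket {a b : ℕ} (i : Fin a) (j : Fin b) : ‖(ket i j : State a b)‖ = 1 := by
  simp [ket]

theorem isOrthogonalSet_of_lt {a b n : ℕ} {S : Fin n → State a b} (h0 : ∀ i, S i ≠ 0)
    (h : ∀ i j, i < j → inner ℂ (S i) (S j) = 0) : IsOrthogonalSet S := by
  refine ⟨h0, fun i j hij => ?_⟩
  rcases lt_or_gt_of_ne hij with h' | h'
  · exact h i j h'
  · exact inner_eq_zero_symm.1 (h j i h')

theorem isOrthogonalSet_three {a b : ℕ} {S : Fin 3 → State a b} (h0 : ∀ i, S i ≠ 0)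
    (h01 : inner ℂ (S 0) (S 1) = 0) (h02 : inner ℂ (S 0) (S 2) = 0)
    (h12 : inner ℂ (S 1) (S 2) = 0) : IsOrthogonalSet S := by
  refine isOrthogonalSet_of_lt h0 fun i j hij => ?_
  fin_cases i <;> fin_cases j <;> first | exact absurd hij (by decide) | assumption

theorem isOrthogonalSet_P01 (ω : ℂ) : IsOrthogonalSet fun i => aliceApply P01 (φ ω i) := by
  simp only [aliceApply_P01_φ]
  refine isOrthogonalSet_three (fun i => ?_) ?_ ?_ ?_
  · fin_cases i
    · exact ne_zero_of_apply (0, 0) (by simp [ket_apply])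
    · exact ne_zero_of_apply (0, 0) (by simp [ket_apply])
    · exact ne_zero_of_apply (0, 1) (by simp [ket_apply])
  all_goals simp [inner_state, Fin.sum_univ_succ, ket_apply, norm_ket]

section

variable {ω : ℂ} (hω : IsPrimitiveRoot ω 3)
include hω

theorem isOrthogonalSet_φ : IsOrthogonalSet (φ ω) := by
  refine isOrthogonalSet_three (fun i => ?_) ?_ ?_ ?_
  · fin_cases i
    · exact ne_zero_of_apply (0, 0) (by simp [φ, ket_apply])
    · exact ne_zero_of_apply (0, 0) (by simp [φ, ket_apply])
    · exact ne_zero_of_apply (0, 1) (by simp [φ, ket_apply])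
  · simp [φ, inner_state, Fin.sum_univ_succ, ket_apply, norm_ket]
    -- The inner product is `1 - 1 - 1 - ω - ω²`.
    linear_combination -one_add_add_sq_eq_zero hω
  all_goals simp [φ, inner_state, Fin.sum_univ_succ, ket_apply]

theorem isOrthogonalSet_P234 : IsOrthogonalSet fun i => aliceApply P234 (φ ω i) := by
  simp only [aliceApply_P234_φ]
  refine isOrthogonalSet_three (fun i => ?_) ?_ ?_ ?_
  · fin_cases i
    · exact ne_zero_of_apply (2, 2) (by simp [ket_apply])
    · exact ne_zero_of_apply (2, 2) (by simp [ket_apply])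
    · exact ne_zero_of_apply (2, 3) (by simp [ket_apply])
  · simp [inner_state, Fin.sum_univ_succ, ket_apply]
    linear_combination -one_add_add_sq_eq_zero hω
  all_goals simp [inner_state, Fin.sum_univ_succ, ket_apply]

theorem isAliceOPLM_φ : IsAliceOPLM ![P01, P234] (φ ω) := by
  refine ⟨isMeasurement_P01_P234, fun k => ?_, fun h => ?_⟩
  · fin_cases k
    · exact (isOrthogonalSet_P01 ω).2
    · exact (isOrthogonalSet_P234 hω).2
  · obtain ⟨c, hc⟩ := h 0
    exact P01_not_scalar c hc

theorem norm_φDiag (i : Fin 5) : ‖φDiag ω i‖ = 1 := by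
  fin_cases i <;> simp [φDiag, norm_primitiveRoot hω]

theorem not_hasLocalRedundancy_φ : ¬ HasLocalRedundancy (φ ω) :=
  not_hasLocalRedundancy (by norm_num) (by decide : (0 : Fin 3) ≠ 1) (by simp) (norm_φDiag hω)
    (φ_zero_eq ω) (φ_one_eq ω)

theorem isMaximallyEntangled_qutritTriple_one : IsMaximallyEntangled (qutritTriple ω 1) := by
  have h : qutritTriple ω 1 = diagState ![-1, -ω, -ω ^ 2] := by
    ext ⟨x, y⟩
    fin_cases x <;> fin_cases y <;> simp [qutritTriple, diagState, ket_apply]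
  rw [h]
  refine isMaximallyEntangled_diagState fun i => ?_
  fin_cases i <;> simp [norm_primitiveRoot hω]

end

/-- The rows are Alice's measurement basis `|0⟩ ± |2⟩`, `|1⟩ + ω^k|3⟩ + ω^(2k)|4⟩`, normalized. -/
def aliceBasis (ω : ℂ) : Matrix (Fin 5) (Fin 5) ℂ :=
  diagonal ![(√2 : ℂ)⁻¹, (√2 : ℂ)⁻¹, (√3 : ℂ)⁻¹, (√3 : ℂ)⁻¹, (√3 : ℂ)⁻¹] *
    !![1, 0, 1, 0, 0; 1, 0, -1, 0, 0; 0, 1, 0, 1, 1; 0, 1, 0, ω, ω ^ 2; 0, 1, 0, ω ^ 2, ω]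

theorem aliceBasis_unitary {ω : ℂ} (hω : IsPrimitiveRoot ω 3) :
    (aliceBasis ω)ᴴ * aliceBasis ω = 1 := by
  have h3 := hω.pow_eq_one
  have h4 : ω ^ 4 = ω := by linear_combination ω * h3
  have hs := one_add_add_sq_eq_zero hω
  -- The matrix is square, so orthonormality of its rows suffices.
  rw [mul_eq_one_comm]
  set T : Matrix (Fin 5) (Fin 5) ℂ :=
    !![1, 0, 1, 0, 0; 1, 0, -1, 0, 0; 0, 1, 0, 1, 1; 0, 1, 0, ω, ω ^ 2; 0, 1, 0, ω ^ 2, ω]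
    with hT
  have hTT : T * Tᴴ = diagonal ![2, 2, 3, 3, 3] := by
    ext i j
    fin_cases i <;> fin_cases j <;>
      simp [hT, mul_apply, Fin.sum_univ_succ, star_primitiveRoot hω]
    all_goals grind
  have h2 : ((√2 : ℂ))⁻¹ * 2 * (√2 : ℂ)⁻¹ = 1 := by
    have : ((√2 : ℝ) : ℂ) ^ 2 = 2 := by rw [← Complex.ofReal_pow]; simp
    have h0 : ((√2 : ℝ) : ℂ) ≠ 0 := by simp
    field_simp; rw [this]
  have h3 : ((√3 : ℂ))⁻¹ * 3 * (√3 : ℂ)⁻¹ = 1 := by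
    have : ((√3 : ℝ) : ℂ) ^ 2 = 3 := by rw [← Complex.ofReal_pow]; simp
    have h0 : ((√3 : ℝ) : ℂ) ≠ 0 := by simp
    field_simp; rw [this]
  rw [aliceBasis, ← hT, conjTranspose_mul, Matrix.mul_assoc, ← Matrix.mul_assoc T, hTT,
    diagonal_conjTranspose, diagonal_mul_diagonal, diagonal_mul_diagonal, ← diagonal_one]
  congr 1; ext i
  fin_cases i <;> simp [← mul_assoc, h2, h3]

/-- Up to scale, a row `|0⟩ ± |2⟩` leaves Bob with `|0⟩ ± |2⟩`, `|0⟩ ∓ |2⟩`, `|1⟩ ± |3⟩`. A row on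
`{1, 3, 4}` annihilates the third state and leaves two vectors whose inner product is a multiple of
`1 + ω + ω²`. -/
theorem locallyDistinguishable_φ {ω : ℂ} (hω : IsPrimitiveRoot ω 3) :
    LocallyDistinguishable (φ ω) := by
  refine locallyDistinguishable_of_unitary (aliceBasis ω) (aliceBasis_unitary hω) fun k => ?_
  have h3 := hω.pow_eq_one
  have hs := one_add_add_sq_eq_zero hω
  suffices h : ∀ i j, i < j → ∑ y, star (∑ x, aliceBasis ω k x * φ ω i (x, y)) *
      ∑ x, aliceBasis ω k x * φ ω j (x, y) = 0 by
    intro i j hij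
    rcases lt_or_gt_of_ne hij with h' | h'
    · exact h i j h'
    · rw [← star_eq_zero, ← h j i h', star_sum]
      refine Finset.sum_congr rfl fun y _ => ?_
      rw [star_mul', star_star, mul_comm]
  intro i j hij
  fin_cases i <;> fin_cases j <;> try exact absurd hij (by decide)
  all_goals
    fin_cases k <;>
      simp [aliceBasis, diagonal_mul, φ, ket_apply, Fin.sum_univ_succ, star_primitiveRoot hω] <;>
      grind

end LOCC

end

theorem mainTheorem2 (ω : ℂ) (hω : IsPrimitiveRoot ω 3) :
    -- the set is orthogonal, without local redundancy, and locally distinguishable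
    LOCC.IsOrthogonalSet (LOCC.φ ω) ∧
    ¬ LOCC.HasLocalRedundancy (LOCC.φ ω) ∧
    LOCC.LocallyDistinguishable (LOCC.φ ω) ∧
    -- the measurement of Alice consists of two orthogonal projectors and is a nontrivial OPLM
    IsStarProjection LOCC.P01 ∧ IsStarProjection LOCC.P234 ∧ LOCC.P01 * LOCC.P234 = 0 ∧
    LOCC.IsAliceOPLM ![LOCC.P01, LOCC.P234] (LOCC.φ ω) ∧
    -- first outcome
    (∀ i, LOCC.aliceApply LOCC.P01 (LOCC.φ ω i) =
      (![LOCC.ket 0 0 + LOCC.ket 1 1, LOCC.ket 0 0 - LOCC.ket 1 1, LOCC.ket 0 1] :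
        Fin 3 → LOCC.State 5 5) i) ∧
    LOCC.IsOrthogonalSet (fun i => LOCC.aliceApply LOCC.P01 (LOCC.φ ω i)) ∧
    ¬ LOCC.LocallyDistinguishable (fun i => LOCC.aliceApply LOCC.P01 (LOCC.φ ω i)) ∧
    LOCC.V01ᴴ * LOCC.V01 = 1 ∧
    (∀ i, LOCC.aliceApply LOCC.P01 (LOCC.φ ω i) =
      LOCC.localApply LOCC.V01 LOCC.V01 (LOCC.qubitTriple i)) ∧
    ¬ LOCC.LocallyDistinguishable LOCC.qubitTriple ∧
    -- second outcome
    (∀ i, LOCC.aliceApply LOCC.P234 (LOCC.φ ω i) =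
      (![LOCC.ket 2 2 + LOCC.ket 3 3 + LOCC.ket 4 4,
        -(LOCC.ket 2 2 + ω • LOCC.ket 3 3 + ω ^ 2 • LOCC.ket 4 4), LOCC.ket 2 3] :
        Fin 3 → LOCC.State 5 5) i) ∧
    LOCC.IsOrthogonalSet (fun i => LOCC.aliceApply LOCC.P234 (LOCC.φ ω i)) ∧
    ¬ LOCC.LocallyDistinguishable (fun i => LOCC.aliceApply LOCC.P234 (LOCC.φ ω i)) ∧
    LOCC.V234ᴴ * LOCC.V234 = 1 ∧
    (∀ i, LOCC.aliceApply LOCC.P234 (LOCC.φ ω i) =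
      LOCC.localApply LOCC.V234 LOCC.V234 (LOCC.qutritTriple ω i)) ∧
    LOCC.IsMaximallyEntangled (LOCC.qutritTriple ω 0) ∧
    LOCC.IsMaximallyEntangled (LOCC.qutritTriple ω 1) ∧
    ¬ LOCC.LocallyDistinguishable (LOCC.qutritTriple ω) := by
  have hA : ¬ LOCC.LocallyDistinguishable (fun i => LOCC.aliceApply LOCC.P01 (LOCC.φ ω i)) := by
    simp only [LOCC.aliceApply_P01_φ_eq_localApply]
    exact fun h => LOCC.not_separablyDistinguishable_qubitTriple
      (.of_isometry LOCC.V01_isometry LOCC.V01_isometry h.separablyDistinguishable)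
  have hB : ¬ LOCC.LocallyDistinguishable (fun i => LOCC.aliceApply LOCC.P234 (LOCC.φ ω i)) := by
    simp only [LOCC.aliceApply_P234_φ_eq_localApply]
    exact fun h => LOCC.not_separablyDistinguishable_qutritTriple hω
      (.of_isometry LOCC.V234_isometry LOCC.V234_isometry h.separablyDistinguishable)
  exact ⟨LOCC.isOrthogonalSet_φ hω, LOCC.not_hasLocalRedundancy_φ hω,
    LOCC.locallyDistinguishable_φ hω, LOCC.isStarProjection_proj _, LOCC.isStarProjection_proj _,
    LOCC.P01_mul_P234, LOCC.isAliceOPLM_φ hω,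
    LOCC.aliceApply_P01_φ ω, LOCC.isOrthogonalSet_P01 ω, hA, LOCC.V01_isometry,
    LOCC.aliceApply_P01_φ_eq_localApply ω,
    fun h => LOCC.not_separablyDistinguishable_qubitTriple h.separablyDistinguishable,
    LOCC.aliceApply_P234_φ ω, LOCC.isOrthogonalSet_P234 hω, hB, LOCC.V234_isometry,
    LOCC.aliceApply_P234_φ_eq_localApply ω,
    LOCC.isMaximallyEntangled_qutritTriple_zero ω, LOCC.isMaximallyEntangled_qutritTriple_one hω,
    fun h => LOCC.not_separablyDistinguishable_qutritTriple hω h.separablyDistinguishable⟩
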